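/- Let $M$ be a smooth manifold (without boundary) of dimension $2h+2k+2$, and let $(\alpha_1,\alpha_2)$ be a contact pair of type $(h,k)$ on $M$: smooth one-forms such that $\alpha_1\wedge(d\alpha_1)^h\wedge\alpha_2\wedge(d\alpha_2)^k$ is a volume form (vanishes nowhere), $(d\alpha_1)^{h+1}=0$ and $(d\alpha_2)^{k+1}=0$. Let $Z_1,Z_2$ be its Reeb vector fields, i.e. the smooth vector fields determined by $\alpha_1(Z_1)=\alpha_2(Z_2)=1$, $\alpha_1(Z_2)=\alpha_2(Z_1)=0$ and $i_{Z_j}d\alpha_i=0$ for $i,j\in\{1,2\}$. Let $\phi$ be a smooth tensor field of type $(1,1)$ on $M$ with $$\phi^2=-\mathrm{Id}+\alpha_1\otimes Z_1+\alpha_2\otimes Z_2,\qquad \phi(Z_1)=\phi(Z_2)=0 ,$$ so that $(\alpha_1,\alpha_2,\phi)$ is a contact pair structure. Use the conventions $(\alpha\otimes Z)(X)=\alpha(X)Z$, $$d\alpha(X,Y)=\tfrac12\bigl(X(\alpha(Y))-Y(\alpha(X))-\alpha([X,Y])\bigr),$$ $$[A,A](X,Y)=A^2[X,Y]+[AX,AY]-A[AX,Y]-A[X,AY]$$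 for a one-form $\alpha$, a vector field $Z$ and a field of endomorphisms $A$; $[A,A]$ is the Nijenhuis tensor of $A$, and an almost complex structure is called integrable if its Nijenhuis tensor vanishes identically. Then $J=\phi-\alpha_2\otimes Z_1+\alpha_1\otimes Z_2$ and $T=\phi+\alpha_2\otimes Z_1-\alpha_1\otimes Z_2$ are almost complex structures ($J^2=T^2=-\mathrm{Id}$), and $J$ and $T$ are both integrable if and only if $$[\phi,\phi](X,Y)+2\,d\alpha_1(X,Y)\,Z_1+2\,d\alpha_2(X,Y)\,Z_2=0$$ for all smooth vector fields $X,Y$ on $M$. -/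

import Mathlib

open scoped Manifold ContDiff

namespace ContactPair

noncomputable section

/-! ### Linear algebra: the wedge product of alternating forms -/

section Wedge

variable {V : Type*} [AddCommGroup V] [Module ℝ V]

/-- The wedge product of alternating forms, with the shuffle normalisation
`(a ∧ b)(v₁, …, vₘ₊ₙ) = ∑ sign(σ) a(v_{σ 1}, …, v_{σ m}) b(v_{σ (m+1)}, …, v_{σ (m+n)})`,
the sum being over the `(m, n)`-shuffles `σ`. -/
def wedge {m n : ℕ} (a : V [⋀^Fin m]→ₗ[ℝ] ℝ) (b : V [⋀^Fin n]→ₗ[ℝ] ℝ) :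
    V [⋀^Fin (m + n)]→ₗ[ℝ] ℝ :=
  ((LinearMap.mul' ℝ ℝ).compAlternatingMap (a.domCoprod b)).domDomCongr finSumFinEquiv

/-- The exterior power `a ∧ ⋯ ∧ a` (`p` factors) of an alternating form; it is `1` for `p = 0`. -/
def wedgePow {m : ℕ} (a : V [⋀^Fin m]→ₗ[ℝ] ℝ) : (p : ℕ) → V [⋀^Fin (m * p)]→ₗ[ℝ] ℝ
  | 0 => haveI : IsEmpty (Fin (m * 0)) := Fin.isEmpty
      AlternatingMap.constOfIsEmpty ℝ V (Fin (m * 0)) 1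
  | p + 1 => wedge (wedgePow a p) a

end Wedge

/-! ### Smooth vector fields, one-forms and fields of endomorphisms -/

section Fields

variable (n : ℕ) (M : Type*) [TopologicalSpace M] [ChartedSpace (EuclideanSpace ℝ (Fin n)) M]
  [IsManifold (𝓡 n) ∞ M]

/-- Smooth vector fields on the `n`-dimensional manifold `M`. -/
abbrev SmoothVectorField : Type _ :=
  Cₛ^∞⟮𝓡 n; EuclideanSpace ℝ (Fin n), fun x : M => TangentSpace (𝓡 n) x⟯

/-- Smooth one-forms on the `n`-dimensional manifold `M`. -/
abbrev SmoothOneForm : Type _ :=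
  Cₛ^∞⟮𝓡 n; EuclideanSpace ℝ (Fin n) →L[ℝ] ℝ, fun x : M => TangentSpace (𝓡 n) x →L[ℝ] ℝ⟯

/-- Smooth tensor fields of type `(1,1)` on the `n`-dimensional manifold `M`, as smooth fields of
endomorphisms of the tangent spaces. -/
abbrev SmoothEndField : Type _ :=
  Cₛ^∞⟮𝓡 n; EuclideanSpace ℝ (Fin n) →L[ℝ] EuclideanSpace ℝ (Fin n),
    fun x : M => TangentSpace (𝓡 n) x →L[ℝ] TangentSpace (𝓡 n) x⟯

end Fields

variable {n : ℕ} {M : Type*} [TopologicalSpace M] [ChartedSpace (EuclideanSpace ℝ (Fin n)) M]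
  [IsManifold (𝓡 n) ∞ M]

/-- The tensor product `α ⊗ Z` of a one-form and a vector field: the field of endomorphisms
`v ↦ α(v) Z`. -/
def tensor (α : SmoothOneForm n M) (Z : SmoothVectorField n M) : SmoothEndField n M where
  toFun x := (α x).smulRight (Z x)
  contMDiff_toFun := by
    intro x₀
    have hα := (contMDiffAt_hom_bundle _).1 (α.contMDiff x₀)
    have hZ := Bundle.contMDiffAt_totalSpace.1 (Z.contMDiff x₀)
    refine (contMDiffAt_hom_bundle _).2 ⟨hα.1, ?_⟩
    have h := ((ContinuousLinearMap.smulRightL ℝ (EuclideanSpace ℝ (Fin n))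
      (EuclideanSpace ℝ (Fin n))).contMDiff.contMDiffAt.comp x₀ hα.2).clm_apply hZ.2
    have hx := (trivializationAt (EuclideanSpace ℝ (Fin n)) (TangentSpace (𝓡 n))
      x₀).open_baseSet.mem_nhds (FiberBundle.mem_baseSet_trivializationAt' x₀)
    refine h.congr_of_eventuallyEq ?_
    filter_upwards [hx] with x hx
    ext1 v
    simp only [ContinuousLinearMap.inCoordinates]
    simp [Bundle.Trivialization.continuousLinearMapAt_apply,
      Bundle.Trivialization.linearMapAt_def_of_mem _ hx]

/-- The almost complex structure `J = φ - α₂ ⊗ Z₁ + α₁ ⊗ Z₂`. -/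
def almostComplexJ (α₁ α₂ : SmoothOneForm n M) (Z₁ Z₂ : SmoothVectorField n M)
    (φ : SmoothEndField n M) : SmoothEndField n M :=
  φ - tensor α₂ Z₁ + tensor α₁ Z₂

/-- The almost complex structure `T = φ + α₂ ⊗ Z₁ - α₁ ⊗ Z₂`. -/
def almostComplexT (α₁ α₂ : SmoothOneForm n M) (Z₁ Z₂ : SmoothVectorField n M)
    (φ : SmoothEndField n M) : SmoothEndField n M :=
  φ + tensor α₂ Z₁ - tensor α₁ Z₂

/-! ### Exterior derivative and Nijenhuis tensor -/

/-- The one-form `α` read in the preferred chart at `x₀`: its pullback to the model space by the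
inverse of the chart. -/
def oneFormInChart (α : SmoothOneForm n M) (x₀ : M) (y : EuclideanSpace ℝ (Fin n)) :
    EuclideanSpace ℝ (Fin n) [⋀^Fin 1]→L[ℝ] ℝ :=
  ContinuousAlternatingMap.ofSubsingleton ℝ (EuclideanSpace ℝ (Fin n)) ℝ (0 : Fin 1)
    ((α ((extChartAt (𝓡 n) x₀).symm y)).comp
      (mfderivWithin 𝓘(ℝ, EuclideanSpace ℝ (Fin n)) (𝓡 n) (extChartAt (𝓡 n) x₀).symm
        (Set.range (𝓡 n)) y))

/-- The exterior derivative of a one-form, computed at `x` in the preferred chart at `x`. It is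
normalised by `dα(X, Y) = ½ (X(α(Y)) - Y(α(X)) - α([X, Y]))`, whereas Mathlib's `extDeriv` does
not have the factor `½`. -/
def extD (α : SmoothOneForm n M) (x : M) : TangentSpace (𝓡 n) x [⋀^Fin 2]→L[ℝ] ℝ :=
  (1 / 2 : ℝ) •
    (extDerivWithin (oneFormInChart α x) (Set.range (𝓡 n))
      (extChartAt (𝓡 n) x x)).compContinuousLinearMap
        (mfderiv (𝓡 n) 𝓘(ℝ, EuclideanSpace ℝ (Fin n)) (extChartAt (𝓡 n) x) x)

/-- The vector field `A X`, for a field of endomorphisms `A` and a vector field `X`. -/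
def applyField (A : SmoothEndField n M) (X : Π x : M, TangentSpace (𝓡 n) x) :
    Π x : M, TangentSpace (𝓡 n) x :=
  fun x => A x (X x)

/-- The Nijenhuis tensor `[A, A](X, Y) = A²[X, Y] + [AX, AY] - A[AX, Y] - A[X, AY]` of a field of
endomorphisms, evaluated on vector fields. -/
def nijenhuis (A : SmoothEndField n M) (X Y : SmoothVectorField n M) (x : M) :
    TangentSpace (𝓡 n) x :=
  A x (A x (VectorField.mlieBracket (𝓡 n) X Y x))
    + VectorField.mlieBracket (𝓡 n) (applyField A X) (applyField A Y) x
    - A x (VectorField.mlieBracket (𝓡 n) (applyField A X) Y x)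
    - A x (VectorField.mlieBracket (𝓡 n) X (applyField A Y) x)

/-- `A` is an almost complex structure: `A² = -Id`. -/
def IsAlmostComplex (A : SmoothEndField n M) : Prop :=
  ∀ (x : M) (v : TangentSpace (𝓡 n) x), A x (A x v) = -v

/-- Integrability of an almost complex structure: its Nijenhuis tensor vanishes identically. -/
def IsIntegrable (A : SmoothEndField n M) : Prop :=
  ∀ (X Y : SmoothVectorField n M) (x : M), nijenhuis A X Y x = 0

/-! ### Contact pairs -/

/-- The value at `x` of a one-form, as an alternating form of degree one. -/
def oneFormAt (α : SmoothOneForm n M) (x : M) : TangentSpace (𝓡 n) x [⋀^Fin 1]→ₗ[ℝ] ℝ :=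
  (ContinuousAlternatingMap.ofSubsingleton ℝ (TangentSpace (𝓡 n) x) ℝ (0 : Fin 1)
    (α x)).toAlternatingMap

/-- The value at `x` of the exterior derivative of a one-form, as an alternating form. -/
def extDAt (α : SmoothOneForm n M) (x : M) : TangentSpace (𝓡 n) x [⋀^Fin 2]→ₗ[ℝ] ℝ :=
  (extD α x).toAlternatingMap

/-- `(α₁, α₂)` is a contact pair of type `(h, k)` on a manifold of dimension `n`. -/
structure IsContactPair (h k : ℕ) (α₁ α₂ : SmoothOneForm n M) : Prop where
  /-- The dimension of the manifold is `2h + 2k + 2`. -/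
  dim_eq : n = 2 * h + 2 * k + 2
  /-- `α₁ ∧ (dα₁)ʰ ∧ α₂ ∧ (dα₂)ᵏ`, a form of top degree, vanishes nowhere. -/
  volume_ne_zero : ∀ x : M,
    wedge (wedge (wedge (oneFormAt α₁ x) (wedgePow (extDAt α₁ x) h)) (oneFormAt α₂ x))
      (wedgePow (extDAt α₂ x) k) ≠ 0
  /-- `(dα₁)ʰ⁺¹ = 0`. -/
  pow_left : ∀ x : M, wedgePow (extDAt α₁ x) (h + 1) = 0
  /-- `(dα₂)ᵏ⁺¹ = 0`. -/
  pow_right : ∀ x : M, wedgePow (extDAt α₂ x) (k + 1) = 0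

/-- `Z₁` and `Z₂` are the Reeb vector fields of the pair `(α₁, α₂)`: `αᵢ(Zⱼ) = δᵢⱼ` and the
contraction of each `dαᵢ` with each `Zⱼ` is zero. -/
structure IsReebPair (α₁ α₂ : SmoothOneForm n M) (Z₁ Z₂ : SmoothVectorField n M) : Prop where
  apply_11 : ∀ x : M, α₁ x (Z₁ x) = 1
  apply_22 : ∀ x : M, α₂ x (Z₂ x) = 1
  apply_12 : ∀ x : M, α₁ x (Z₂ x) = 0
  apply_21 : ∀ x : M, α₂ x (Z₁ x) = 0
  contract_11 : ∀ (x : M) (v : TangentSpace (𝓡 n) x), extD α₁ x ![Z₁ x, v] = 0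
  contract_12 : ∀ (x : M) (v : TangentSpace (𝓡 n) x), extD α₂ x ![Z₁ x, v] = 0
  contract_21 : ∀ (x : M) (v : TangentSpace (𝓡 n) x), extD α₁ x ![Z₂ x, v] = 0
  contract_22 : ∀ (x : M) (v : TangentSpace (𝓡 n) x), extD α₂ x ![Z₂ x, v] = 0

/-- `(α₁, α₂, φ)` is a contact pair structure of type `(h, k)`, and `Z₁`, `Z₂` are the Reeb vector
fields of the contact pair `(α₁, α₂)`. -/
structure IsContactPairStructure (h k : ℕ) (α₁ α₂ : SmoothOneForm n M)
    (Z₁ Z₂ : SmoothVectorField n M) (φ : SmoothEndField n M) : Prop where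
  isContactPair : IsContactPair h k α₁ α₂
  isReebPair : IsReebPair α₁ α₂ Z₁ Z₂
  /-- `φ² = -Id + α₁ ⊗ Z₁ + α₂ ⊗ Z₂`. -/
  sq_eq : ∀ (x : M) (v : TangentSpace (𝓡 n) x),
    φ x (φ x v) = -v + α₁ x v • Z₁ x + α₂ x v • Z₂ x
  apply_reeb₁ : ∀ x : M, φ x (Z₁ x) = 0
  apply_reeb₂ : ∀ x : M, φ x (Z₂ x) = 0

end

end ContactPair

/-! Put R = α₁ ⊗ Z₂ - α₂ ⊗ Z₁, so that J = φ + R and T = φ - R. The Nijenhuis tensor is quadratic in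
the endomorphism field, hence N_{φ ± R} = N_φ ± (mixed term) + N_R (`nijenhuis_add_smul`). The Reeb
fields commute, and this gives N_R = 2dα₁ ⊗ Z₁ + 2dα₂ ⊗ Z₂ (`nijenhuis_reebRotation`). With E = N_φ
+ N_R, the tensor of the statement, N_J = E + mixed and N_T = E - mixed, so integrability of both
means that E and the mixed term vanish.

It remains to see that E = 0 kills the mixed term (`nijenhuisMixed_eq_zero`). Evaluating E on (X,
Zⱼ) shows that bracketing with Zⱼ commutes with φ (`mlieBracket_phi`). Applying αᵢ to E shows that
dαᵢ is φ-invariant, so dαᵢ(φX, Y) + dαᵢ(X, φY) = 0 (`extD_phi`). The mixed term is a combination of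
these expressions.

The Reeb fields commute because [Z₁, Z₂] lies in the kernels of α₁, α₂, dα₁ and dα₂, and a nonzero
such vector would make the volume form vanish. -/

namespace ContactPair

noncomputable section

/-! ### Nondegeneracy of the volume form -/

section Annihilation

variable {V : Type*} [AddCommGroup V] [Module ℝ V]

/-- The alternating form `a` is annihilated by the contraction with `w`. -/
def Annihilates {m : ℕ} (w : V) (a : V [⋀^Fin m]→ₗ[ℝ] ℝ) : Prop :=
  ∀ (v : Fin m → V) (i : Fin m), v i = w → a v = 0

/-- Each shuffle sends the slot holding `w` into one of the two factors, and that factor vanishes.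
-/
theorem Annihilates.wedge {m n : ℕ} {w : V} {a : V [⋀^Fin m]→ₗ[ℝ] ℝ} {b : V [⋀^Fin n]→ₗ[ℝ] ℝ}
    (ha : Annihilates w a) (hb : Annihilates w b) : Annihilates w (wedge a b) := by
  intro v i hi
  have key : a.domCoprod b (v ∘ finSumFinEquiv) = 0 := by
    rw [AlternatingMap.domCoprod_apply, sum_apply]
    refine Finset.sum_eq_zero fun σ _ ↦ ?_
    induction σ using Quotient.inductionOn' with | _ σ
    rw [AlternatingMap.domCoprod.summand_mk'']
    simp only [smul_apply, MultilinearMap.domDomCongr_apply,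
      MultilinearMap.domCoprod_apply]
    rcases hj : σ.symm (finSumFinEquiv.symm i) with j | j
    · have h0 : a (fun l ↦ (v ∘ finSumFinEquiv) (σ (Sum.inl l))) = 0 :=
        ha _ j (by simp [← hj, hi])
      simp_all
    · have h0 : b (fun l ↦ (v ∘ finSumFinEquiv) (σ (Sum.inr l))) = 0 :=
        hb _ j (by simp [← hj, hi])
      simp_all
  simp only [ContactPair.wedge, AlternatingMap.domDomCongr_apply,
    LinearMap.compAlternatingMap_apply]
  erw [key, map_zero]

theorem Annihilates.wedgePow {m : ℕ} {w : V} {a : V [⋀^Fin m]→ₗ[ℝ] ℝ} (ha : Annihilates w a) :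
    ∀ p : ℕ, Annihilates w (wedgePow a p)
  -- A form of degree zero has no slots, so the condition is vacuous even for the constant `1`.
  | 0 => fun _ i ↦ absurd i.isLt (by simp)
  | p + 1 => (ha.wedgePow p).wedge ha

/-- A nonzero form of top degree is nonzero on every basis, and a nonzero `w` extends to a basis. -/
theorem Annihilates.eq_zero_of_finrank_eq [FiniteDimensional ℝ V] {m : ℕ} {w : V}
    {a : V [⋀^Fin m]→ₗ[ℝ] ℝ} (ha : Annihilates w a) (hm : Module.finrank ℝ V = m) (ha0 : a ≠ 0) :
    w = 0 := by
  by_contra hw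
  have hli : LinearIndepOn ℝ id ({w} : Set V) := LinearIndepOn.singleton (v := id) hw
  let e := Module.Basis.extend hli
  have := Module.Finite.finite_basis e
  have hw' : w ∈ hli.extend (Set.subset_univ _) := hli.subset_extend _ rfl
  let f : hli.extend (Set.subset_univ _) ≃ Fin m :=
    (Finite.equivFin _).trans (finCongr (by rw [← hm, Module.finrank_eq_nat_card_basis e]))
  exact ha0 ((a.map_basis_eq_zero_iff (e.reindex f)).1
    (ha _ (f ⟨w, hw'⟩) (by simp [e])))

end Annihilation

/-! ### Smoothness -/

variable {n : ℕ} {M : Type*} [TopologicalSpace M] [ChartedSpace (EuclideanSpace ℝ (Fin n)) M]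
  [IsManifold (𝓡 n) ∞ M]

/-- The smooth vector field `A X`. -/
def applySection (A : SmoothEndField n M) (X : SmoothVectorField n M) : SmoothVectorField n M where
  toFun := applyField A X
  contMDiff_toFun := A.contMDiff.clm_bundle_apply X.contMDiff

/-- The vector field `X` is differentiable at `x`. -/
abbrev DiffFieldAt (X : Π x : M, TangentSpace (𝓡 n) x) (x : M) : Prop :=
  MDifferentiableAt (𝓡 n) ((𝓡 n).prod 𝓘(ℝ, EuclideanSpace ℝ (Fin n)))
    (fun y ↦ Bundle.TotalSpace.mk' (EuclideanSpace ℝ (Fin n)) y (X y)) x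

theorem mdifferentiableAt_pairing (α : SmoothOneForm n M) {X : Π x : M, TangentSpace (𝓡 n) x}
    {x : M} (hX : DiffFieldAt X x) :
    MDifferentiableAt (𝓡 n) 𝓘(ℝ, ℝ) (fun y ↦ α y (X y)) x := by
  have h := MDifferentiableAt.clm_bundle_apply (F₁ := EuclideanSpace ℝ (Fin n)) (F₂ := ℝ)
      (E₁ := fun x : M ↦ TangentSpace (𝓡 n) x) (E₂ := Bundle.Trivial M ℝ) (b := id)
      (ϕ := fun y ↦ α y) (α.mdifferentiableAt (x := x)) hX
  exact ((mdifferentiableAt_totalSpace _ _).1 h).2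

open VectorField

/-! ### The invariant formula for `dα`, proved in a chart -/

/-- The derivative at `x` of the function `f` along the tangent vector `v`. -/
abbrev dirDeriv (f : M → ℝ) (x : M) (v : TangentSpace (𝓡 n) x) : ℝ :=
  mvfderiv (𝓡 n) f x v

/-- The exterior derivative of a one-form on a normed space, evaluated on vector fields. -/
theorem extDerivWithin_ofSubsingleton_apply {E : Type*} [NormedAddCommGroup E] [NormedSpace ℝ E]
    {a : E → E →L[ℝ] ℝ} {X Y : E → E} {s : Set E} {y : E} (ha : DifferentiableWithinAt ℝ a s y)
    (hX : DifferentiableWithinAt ℝ X s y) (hY : DifferentiableWithinAt ℝ Y s y)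
    (hs : UniqueDiffWithinAt ℝ s y) :
    extDerivWithin (fun z ↦ ContinuousAlternatingMap.ofSubsingleton ℝ E ℝ (0 : Fin 1) (a z)) s y
        ![X y, Y y] =
      fderivWithin ℝ (fun z ↦ a z (Y z)) s y (X y) - fderivWithin ℝ (fun z ↦ a z (X z)) s y (Y y)
        - a y (lieBracketWithin ℝ X Y s y) := by
  have hω : DifferentiableWithinAt ℝ
      (fun z ↦ ContinuousAlternatingMap.ofSubsingleton ℝ E ℝ (0 : Fin 1) (a z)) s y :=
    (ContinuousAlternatingMap.ofSubsingletonLIE (𝕜 := ℝ) (E := E) (F := ℝ) (0 : Fin 1)).toContinuousLinearEquiv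
      |>.toContinuousLinearMap.differentiableAt.comp_differentiableWithinAt y ha
  have key := extDerivWithin_apply_vectorField hω (V := ![X, Y])
    (by simp [Fin.forall_fin_two, hX, hY]) hs
  have hv : (fun i ↦ (![X, Y] : Fin 2 → E → E) i y) = ![X y, Y y] := by
    ext i; fin_cases i <;> rfl
  rw [hv] at key
  rw [key]
  simp [Fin.sum_univ_succ, Fin.removeNth, sub_eq_add_neg]

/-- The representative of a one-form in the chart at `x`. -/
def chartForm (α : SmoothOneForm n M) (x : M) (y : EuclideanSpace ℝ (Fin n)) :
    EuclideanSpace ℝ (Fin n) →L[ℝ] ℝ :=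
  (α ((extChartAt (𝓡 n) x).symm y)).comp
      (mfderivWithin 𝓘(ℝ, EuclideanSpace ℝ (Fin n)) (𝓡 n) (extChartAt (𝓡 n) x).symm
        (Set.range (𝓡 n)) y)

/-- The representative of a vector field in the chart at `x`. -/
def chartField (X : Π x : M, TangentSpace (𝓡 n) x) (x : M) :
    EuclideanSpace ℝ (Fin n) → EuclideanSpace ℝ (Fin n) :=
  mpullbackWithin 𝓘(ℝ, EuclideanSpace ℝ (Fin n)) (𝓡 n) (extChartAt (𝓡 n) x).symm X
    (Set.range (𝓡 n))

theorem differentiableWithinAt_chartForm (α : SmoothOneForm n M) (x : M) :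
    DifferentiableWithinAt ℝ (chartForm α x) (Set.range (𝓡 n)) (extChartAt (𝓡 n) x x) := by
  have hα := ((mdifferentiableAt_hom_bundle _).1 (α.mdifferentiableAt (x := x))).2
  have h1 :=
    (hα.mdifferentiableWithinAt (s := Set.univ)).differentiableWithinAt_comp_extChartAt_symm
  simp only [Set.preimage_univ, Set.univ_inter] at h1
  -- On the chart domain, the representative is the coordinate expression of the section in the
  -- trivialization at `x`, whose differentiability is known.
  have hev : ∀ y ∈ (extChartAt (𝓡 n) x).target, chartForm α x y =
      ContinuousLinearMap.inCoordinates (EuclideanSpace ℝ (Fin n)) (fun x : M ↦ TangentSpace (𝓡 n) x)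
      ℝ (fun _ : M ↦ ℝ) x ((extChartAt (𝓡 n) x).symm y) x ((extChartAt (𝓡 n) x).symm y)
      (α ((extChartAt (𝓡 n) x).symm y)) := by
    intro y hy
    have hs := (extChartAt (𝓡 n) x).map_target hy
    rw [ContinuousLinearMap.inCoordinates, TangentBundle.symmL_trivializationAt (by simpa using hs),
      (extChartAt (𝓡 n) x).right_inv hy]
    ext v
    simp [chartForm]
  refine h1.congr_of_eventuallyEq ?_ (hev _ (mem_extChartAt_target x))
  filter_upwards [extChartAt_target_mem_nhdsWithin (I := 𝓡 n) x] with y hy using hev y hy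

theorem differentiableWithinAt_chartField {X : Π x : M, TangentSpace (𝓡 n) x} {x : M}
    (hX : DiffFieldAt X x) :
    DifferentiableWithinAt ℝ (chartField X x) (Set.range (𝓡 n)) (extChartAt (𝓡 n) x x) := by
  have h := MDifferentiableWithinAt.differentiableWithinAt_mpullbackWithin_vectorField
    (hX.mdifferentiableWithinAt (s := Set.univ))
  rwa [Set.preimage_univ, Set.univ_inter] at h

theorem chartForm_chartField (α : SmoothOneForm n M) (X : Π x : M, TangentSpace (𝓡 n) x) (x : M)
    {y : EuclideanSpace ℝ (Fin n)} (hy : y ∈ (extChartAt (𝓡 n) x).target) :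
    chartForm α x y (chartField X x y) =
      α ((extChartAt (𝓡 n) x).symm y) (X ((extChartAt (𝓡 n) x).symm y)) := by
  have hi := isInvertible_mfderivWithin_extChartAt_symm (I := 𝓡 n) hy
  exact congrArg (α _) (hi.self_apply_inverse _)

theorem fderivWithin_chartForm_chartField (α : SmoothOneForm n M)
    {X : Π x : M, TangentSpace (𝓡 n) x} {x : M} (hX : DiffFieldAt X x) (v : TangentSpace (𝓡 n) x) :
    fderivWithin ℝ (fun y ↦ chartForm α x y (chartField X x y)) (Set.range (𝓡 n))
      (extChartAt (𝓡 n) x x) v = dirDeriv (fun y ↦ α y (X y)) x v := by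
  have h : (fun y ↦ chartForm α x y (chartField X x y))
      =ᶠ[nhdsWithin (extChartAt (𝓡 n) x x) (Set.range (𝓡 n))]
      (fun y ↦ α y (X y)) ∘ (extChartAt (𝓡 n) x).symm := by
    filter_upwards [extChartAt_target_mem_nhdsWithin (I := 𝓡 n) x] with y hy using
      chartForm_chartField α X x hy
  rw [h.fderivWithin_eq (chartForm_chartField α X x (mem_extChartAt_target x)), dirDeriv, mvfderiv,
    (mdifferentiableAt_pairing α hX).mfderiv]
  rfl

theorem chartField_self (X : Π x : M, TangentSpace (𝓡 n) x) (x : M) :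
    chartField X x (extChartAt (𝓡 n) x x) = X x := by
  -- The tangent spaces at `y` and at `x` are both the model space by definition; stating the
  -- equality there avoids a transport.
  have h : ∀ y, y = x → (X y : EuclideanSpace ℝ (Fin n)) = X x := by rintro y rfl; rfl
  exact (mfderivWithin_extChartAt_symm_inverse_apply (I := 𝓡 n) (x := x) _).trans
    (h _ (extChartAt_to_inv x))

/-- The formula `2 dα(X, Y) = X(α(Y)) - Y(α(X)) - α([X, Y])`. -/
theorem two_mul_extD_apply (α : SmoothOneForm n M) {X Y : Π x : M, TangentSpace (𝓡 n) x} {x : M}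
    (hX : DiffFieldAt X x) (hY : DiffFieldAt Y x) :
    2 * extD α x ![X x, Y x] =
      dirDeriv (fun y ↦ α y (Y y)) x (X x) - dirDeriv (fun y ↦ α y (X y)) x (Y x)
        - α x (mlieBracket (𝓡 n) X Y x) := by
  have key := extDerivWithin_ofSubsingleton_apply (differentiableWithinAt_chartForm α x)
    (differentiableWithinAt_chartField hX) (differentiableWithinAt_chartField hY)
    ((𝓡 n).uniqueDiffWithinAt_image)
  have hL : ((extDerivWithin (oneFormInChart α x) (Set.range (𝓡 n))
      (extChartAt (𝓡 n) x x)).compContinuousLinearMap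
        (mfderiv (𝓡 n) 𝓘(ℝ, EuclideanSpace ℝ (Fin n)) (extChartAt (𝓡 n) x) x)) ![X x, Y x] =
      extDerivWithin (oneFormInChart α x) (Set.range (𝓡 n)) (extChartAt (𝓡 n) x x)
        ![chartField X x (extChartAt (𝓡 n) x x), chartField Y x (extChartAt (𝓡 n) x x)] := by
    -- The derivative of the preferred chart at its own base point is the identity of the model
    -- space.
    rw [mfderiv_extChartAt_self, chartField_self, chartField_self]
    rfl
  have hB : chartForm α x (extChartAt (𝓡 n) x x) (lieBracketWithin ℝ (chartField X x)
      (chartField Y x) (Set.range (𝓡 n)) (extChartAt (𝓡 n) x x)) =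
      α x (mlieBracket (𝓡 n) X Y x) := by
    have h : ∀ (u : EuclideanSpace ℝ (Fin n)) (y : M), y = x →
        (α y : EuclideanSpace ℝ (Fin n) →L[ℝ] ℝ) u =
          (α x : EuclideanSpace ℝ (Fin n) →L[ℝ] ℝ) u := by rintro u y rfl; rfl
    have h1 : mlieBracket (𝓡 n) X Y x = lieBracketWithin ℝ (chartField X x)
        (chartField Y x) (Set.range (𝓡 n)) (extChartAt (𝓡 n) x x) := by
      rw [← mlieBracketWithin_univ, mlieBracketWithin_apply, mfderiv_extChartAt_self,
        Set.preimage_univ, Set.univ_inter]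
      exact congrArg (fun L : EuclideanSpace ℝ (Fin n) →L[ℝ] EuclideanSpace ℝ (Fin n) ↦ L _)
        ContinuousLinearMap.inverse_id
    rw [h1]
    refine Eq.trans ?_ (h _ _ (extChartAt_to_inv (I := 𝓡 n) x))
    rw [chartForm, mfderivWithin_range_extChartAt_symm]
    rfl
  have h2 : 2 * extD α x ![X x, Y x] = extDerivWithin (oneFormInChart α x) (Set.range (𝓡 n))
      (extChartAt (𝓡 n) x x)
        ![chartField X x (extChartAt (𝓡 n) x x), chartField Y x (extChartAt (𝓡 n) x x)] := by
    rw [← hL]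
    change 2 * ((1 / 2 : ℝ) * _) = _
    rw [← mul_assoc, mul_one_div_cancel two_ne_zero, one_mul]
    rfl
  rw [h2, ← fderivWithin_chartForm_chartField α hX, ← fderivWithin_chartForm_chartField α hY, ← hB,
    ← chartField_self X, ← chartField_self Y]
  exact key

/-! ### `dα` as a bilinear form at a point -/

theorem extD_swap (α : SmoothOneForm n M) (x : M) (v w : TangentSpace (𝓡 n) x) :
    extD α x ![v, w] = -extD α x ![w, v] := by
  have h := (extD α x).toAlternatingMap.map_swap ![w, v] (i := 0) (j := 1) (by simp)
  have e : ![w, v] ∘ Equiv.swap 0 1 = ![v, w] := by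
    ext1 i; fin_cases i <;> simp
  rw [e] at h
  exact h

theorem extD_add_left (α : SmoothOneForm n M) (x : M) (v v' w : TangentSpace (𝓡 n) x) :
    extD α x ![v + v', w] = extD α x ![v, w] + extD α x ![v', w] :=
  (extD α x).toMultilinearMap.cons_add ![w] v v'

theorem extD_smul_left (α : SmoothOneForm n M) (x : M) (c : ℝ) (v w : TangentSpace (𝓡 n) x) :
    extD α x ![c • v, w] = c • extD α x ![v, w] :=
  (extD α x).toMultilinearMap.cons_smul ![w] c v

/-- The exterior derivative of a one-form as a bilinear form. -/
def extDBilin (α : SmoothOneForm n M) (x : M) :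
    TangentSpace (𝓡 n) x →ₗ[ℝ] TangentSpace (𝓡 n) x →ₗ[ℝ] ℝ :=
  LinearMap.mk₂ ℝ (fun v w ↦ extD α x ![v, w]) (extD_add_left α x) (extD_smul_left α x)
    (fun v w w' ↦ by
      rw [extD_swap, extD_add_left, extD_swap α x v w, extD_swap α x v w', neg_add])
    (fun c v w ↦ by rw [extD_swap, extD_smul_left, extD_swap α x v w, smul_neg])

theorem extDBilin_apply (α : SmoothOneForm n M) (x : M) (v w : TangentSpace (𝓡 n) x) :
    extDBilin α x v w = extD α x ![v, w] := rfl

theorem extDBilin_swap (α : SmoothOneForm n M) (x : M) (v w : TangentSpace (𝓡 n) x) :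
    extDBilin α x v w = -extDBilin α x w v :=
  extD_swap α x v w

/-! ### Reeb fields and their brackets -/

/-- The vector field `Z` is a Reeb field of `α` relative to the constant value `c`. -/
structure IsReebFor (α : SmoothOneForm n M) (Z : SmoothVectorField n M) (c : ℝ) : Prop where
  apply_eq : ∀ x, α x (Z x) = c
  contract : ∀ x v, extDBilin α x (Z x) v = 0

theorem IsReebFor.contract_right {α : SmoothOneForm n M} {Z : SmoothVectorField n M} {c : ℝ}
    (h : IsReebFor α Z c) (x : M) (v : TangentSpace (𝓡 n) x) : extDBilin α x v (Z x) = 0 := by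
  rw [extDBilin_swap, h.contract, neg_zero]

omit [IsManifold (𝓡 n) ∞ M] in
theorem dirDeriv_const (c : ℝ) (x : M) (v : TangentSpace (𝓡 n) x) :
    dirDeriv (fun _ : M ↦ c) x v = 0 := by
  rw [dirDeriv, mvfderiv_const]; rfl

omit [IsManifold (𝓡 n) ∞ M] in
theorem dirDeriv_of_eventuallyEq {f g : M → ℝ} {x : M} (h : f =ᶠ[nhds x] g)
    (v : TangentSpace (𝓡 n) x) : dirDeriv f x v = dirDeriv g x v := by
  have : mfderiv (𝓡 n) 𝓘(ℝ, ℝ) f x = mfderiv (𝓡 n) 𝓘(ℝ, ℝ) g x := h.mfderiv_eq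
  have h2 := DFunLike.congr_fun this v
  exact h2

/-- `α([Z, X]) = Z(α(X))` for a Reeb field `Z`. -/
theorem IsReebFor.apply_mlieBracket {α : SmoothOneForm n M} {Z : SmoothVectorField n M} {c : ℝ}
    (h : IsReebFor α Z c) {X : Π x : M, TangentSpace (𝓡 n) x} {x : M} (hX : DiffFieldAt X x) :
    α x (mlieBracket (𝓡 n) Z X x) = dirDeriv (fun y ↦ α y (X y)) x (Z x) := by
  have key := two_mul_extD_apply α (Z.mdifferentiableAt (x := x)) hX
  rw [← extDBilin_apply, h.contract, dirDeriv_of_eventuallyEq (f := fun y ↦ α y (Z y))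
    (g := fun _ ↦ c) (.of_forall h.apply_eq), dirDeriv_const] at key
  linarith

/-- Bracketing with a Reeb field sends fields with locally constant α(X) into ker α. Constancy is
asked only near `x`, because nested brackets are controlled only there. -/
theorem IsReebFor.apply_mlieBracket_eq_zero {α : SmoothOneForm n M} {Z : SmoothVectorField n M}
    {c : ℝ} (h : IsReebFor α Z c) {X : Π x : M, TangentSpace (𝓡 n) x} {x : M} {d : ℝ}
    (hX : DiffFieldAt X x) (hd : ∀ᶠ y in nhds x, α y (X y) = d) :
    α x (mlieBracket (𝓡 n) Z X x) = 0 := by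
  rw [h.apply_mlieBracket hX, dirDeriv_of_eventuallyEq (g := fun _ ↦ d) hd, dirDeriv_const]

theorem two_le_infty : (2 : WithTop ℕ∞) ≤ ∞ :=
  WithTop.coe_le_coe.2 (le_top (a := (2 : ℕ∞)))

/-- The vector field `X` is twice continuously differentiable at `x`. -/
abbrev C2FieldAt (X : Π x : M, TangentSpace (𝓡 n) x) (x : M) : Prop :=
  ContMDiffAt (𝓡 n) ((𝓡 n).prod 𝓘(ℝ, EuclideanSpace ℝ (Fin n))) 2
    (fun y ↦ Bundle.TotalSpace.mk' (EuclideanSpace ℝ (Fin n)) y (X y)) x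

theorem SmoothVectorField.c2 (X : SmoothVectorField n M) (x : M) : C2FieldAt X x :=
  (X.contMDiff x).of_le two_le_infty

theorem C2FieldAt.eventually_diffFieldAt {X : Π x : M, TangentSpace (𝓡 n) x} {x : M}
    (hX : C2FieldAt X x) : ∀ᶠ y in nhds x, DiffFieldAt X y := by
  filter_upwards [(contMDiffAt_iff_contMDiffAt_nhds (by simp)).1 hX] with y hy using
    hy.mdifferentiableAt (by simp)

theorem C2FieldAt.diffFieldAt_mlieBracket {X Y : Π x : M, TangentSpace (𝓡 n) x} {x : M}
    (hX : C2FieldAt X x) (hY : C2FieldAt Y x) : DiffFieldAt (mlieBracket (𝓡 n) X Y) x := by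
  have : IsManifold (𝓡 n) (((2 : ℕ∞) : WithTop ℕ∞) + 1) M :=
    IsManifold.of_le (n := ∞) (by exact mod_cast le_top)
  have : IsManifold (𝓡 n) (minSmoothness ℝ 2) M := by
    rw [minSmoothness_of_isRCLikeNormedField]
    exact IsManifold.of_le (n := ∞) two_le_infty
  refine ContMDiffAt.mdifferentiableAt (n := ((1 : ℕ∞) : WithTop ℕ∞))
    (ContMDiffAt.mlieBracket_vectorField (n := 2) hX hY ?_) (by simp)
  rw [minSmoothness_of_isRCLikeNormedField]
  norm_num

/-- There is a vector field in the kernel of `α` near `x` with a prescribed value at `x` up to a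
multiple of a vector field `R` with `α(R) = 1`. -/
theorem exists_field_in_ker (α : SmoothOneForm n M) (R : SmoothVectorField n M)
    (hR : ∀ y, α y (R y) = 1) (x : M) (v : TangentSpace (𝓡 n) x) :
    ∃ X : Π x : M, TangentSpace (𝓡 n) x, C2FieldAt X x ∧ (∀ y, α y (X y) = 0) ∧
      X x = v - α x v • R x := by
  -- The extension of `v` is known to be regular only at `x`, hence the pointwise regularity in the
  -- conclusion. It is then projected to ker α along `R`.
  let U := FiberBundle.extend (EuclideanSpace ℝ (Fin n)) v
  have hU : C2FieldAt U x := FiberBundle.contMDiffAt_extend (𝓡 n) _ v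
  have hf : ContMDiffAt (𝓡 n) 𝓘(ℝ, ℝ) 2 (fun y ↦ α y (U y)) x := by
    have h := ContMDiffAt.clm_bundle_apply (F₁ := EuclideanSpace ℝ (Fin n)) (F₂ := ℝ)
      (E₁ := fun x : M ↦ TangentSpace (𝓡 n) x) (E₂ := Bundle.Trivial M ℝ) (b := id)
      (ϕ := fun y ↦ α y) ((α.contMDiff x).of_le two_le_infty) hU
    exact (Bundle.contMDiffAt_totalSpace.1 h).2
  refine ⟨fun y ↦ U y - α y (U y) • R y, hU.sub_section (hf.smul_section (R.c2 x)), ?_, ?_⟩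
  · intro y
    simp [hR]
  · simp [U]

/-- The bracket of two Reeb fields of `α` is in the kernels of `α` and `dα`. -/
theorem IsReebFor.mlieBracket {α : SmoothOneForm n M} {Z W R : SmoothVectorField n M} {c d : ℝ}
    (hZ : IsReebFor α Z c) (hW : IsReebFor α W d) (hR : IsReebFor α R 1) (x : M) :
    α x (mlieBracket (𝓡 n) Z W x) = 0 ∧
      ∀ v, extDBilin α x (mlieBracket (𝓡 n) Z W x) v = 0 := by
  have h0 : ∀ y, α y (VectorField.mlieBracket (𝓡 n) Z W y) = 0 := fun y ↦
    hZ.apply_mlieBracket_eq_zero W.mdifferentiableAt (.of_forall hW.apply_eq)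
  refine ⟨h0 x, fun v ↦ ?_⟩
  obtain ⟨X, hX, hX0, hXx⟩ := exists_field_in_ker α R hR.apply_eq x v
  -- Bracketing with `W`, then with `Z`, keeps `X` in ker α.
  have hnest : ∀ {Z W : SmoothVectorField n M} {c d : ℝ}, IsReebFor α Z c → IsReebFor α W d →
      α x (VectorField.mlieBracket (𝓡 n) Z (VectorField.mlieBracket (𝓡 n) W X) x) = 0 := by
    intro Z W c d hZ hW
    refine hZ.apply_mlieBracket_eq_zero (d := 0) ((W.c2 x).diffFieldAt_mlieBracket hX) ?_
    filter_upwards [hX.eventually_diffFieldAt] with y hy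
    exact hW.apply_mlieBracket_eq_zero hy (.of_forall hX0)
  have : IsManifold (𝓡 n) (minSmoothness ℝ 3) M := by
    rw [minSmoothness_of_isRCLikeNormedField]
    exact IsManifold.of_le (n := ∞) (WithTop.coe_le_coe.2 (le_top (a := (3 : ℕ∞))))
  -- By the Jacobi identity, [[Z, W], X] is a difference of two nested brackets in ker α.
  have hJ := leibniz_identity_mlieBracket_apply (I := 𝓡 n) (𝕜 := ℝ) (U := Z) (V := W) (W := X)
    (x := x) (by simpa [minSmoothness_of_isRCLikeNormedField] using Z.c2 x)
    (by simpa [minSmoothness_of_isRCLikeNormedField] using W.c2 x)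
    (by simpa [minSmoothness_of_isRCLikeNormedField] using hX)
  have hJ' := congrArg (α x) hJ
  rw [map_add, hnest hZ hW, hnest hW hZ, add_zero] at hJ'
  have key := two_mul_extD_apply α ((Z.c2 x).diffFieldAt_mlieBracket (W.c2 x))
    hX.eventually_diffFieldAt.self_of_nhds
  -- All three terms of 2dα([Z, W], X) vanish. Since `v` and `X x` differ by a multiple of `R`,
  -- which contracts dα to zero, the same holds for `v`.
  rw [← hJ', dirDeriv_of_eventuallyEq (f := fun y ↦ α y (X y)) (g := fun _ ↦ 0) (.of_forall hX0),
    dirDeriv_of_eventuallyEq (g := fun _ ↦ 0) (.of_forall h0), dirDeriv_const, dirDeriv_const,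
    ← extDBilin_apply, hXx, map_sub, map_smul, hR.contract_right] at key
  simpa using key

variable {α₁ α₂ : SmoothOneForm n M} {Z₁ Z₂ : SmoothVectorField n M}

theorem IsReebPair.isReebFor_11 (h : IsReebPair α₁ α₂ Z₁ Z₂) : IsReebFor α₁ Z₁ 1 :=
  ⟨h.apply_11, h.contract_11⟩

theorem IsReebPair.isReebFor_12 (h : IsReebPair α₁ α₂ Z₁ Z₂) : IsReebFor α₁ Z₂ 0 :=
  ⟨h.apply_12, h.contract_21⟩

theorem IsReebPair.isReebFor_21 (h : IsReebPair α₁ α₂ Z₁ Z₂) : IsReebFor α₂ Z₁ 0 :=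
  ⟨h.apply_21, h.contract_12⟩

theorem IsReebPair.isReebFor_22 (h : IsReebPair α₁ α₂ Z₁ Z₂) : IsReebFor α₂ Z₂ 1 :=
  ⟨h.apply_22, h.contract_22⟩

theorem annihilates_oneFormAt {α : SmoothOneForm n M} {x : M} {w : TangentSpace (𝓡 n) x}
    (h : α x w = 0) : Annihilates w (oneFormAt α x) := by
  intro v i hi
  obtain rfl : i = 0 := Subsingleton.elim _ _
  exact (congrArg (α x) hi).trans h

theorem annihilates_extDAt {α : SmoothOneForm n M} {x : M} {w : TangentSpace (𝓡 n) x}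
    (h : ∀ v, extDBilin α x w v = 0) : Annihilates w (extDAt α x) := by
  intro v i hi
  have hv : extDAt α x v = extDBilin α x (v 0) (v 1) := by
    rw [extDBilin_apply]
    refine congrArg (extD α x) ?_
    ext i; fin_cases i <;> rfl
  rw [hv]
  fin_cases i
  · change v 0 = w at hi
    rw [hi, h]
  · change v 1 = w at hi
    rw [hi, extDBilin_swap, h, neg_zero]

/-- The kernels of `α₁`, `dα₁`, `α₂`, `dα₂` of a contact pair meet in zero. -/
theorem IsContactPair.eq_zero {h k : ℕ} (hc : IsContactPair h k α₁ α₂) {x : M}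
    {w : TangentSpace (𝓡 n) x} (h₁ : α₁ x w = 0) (h₂ : α₂ x w = 0)
    (hd₁ : ∀ v, extDBilin α₁ x w v = 0) (hd₂ : ∀ v, extDBilin α₂ x w v = 0) : w = 0 := by
  have hA := (((annihilates_oneFormAt h₁).wedge ((annihilates_extDAt hd₁).wedgePow h)).wedge
    (annihilates_oneFormAt h₂)).wedge ((annihilates_extDAt hd₂).wedgePow k)
  have : FiniteDimensional ℝ (TangentSpace (𝓡 n) x) :=
    inferInstanceAs (FiniteDimensional ℝ (EuclideanSpace ℝ (Fin n)))
  refine hA.eq_zero_of_finrank_eq ?_ (hc.volume_ne_zero x)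
  have : Module.finrank ℝ (TangentSpace (𝓡 n) x) = n :=
    (finrank_euclideanSpace_fin : Module.finrank ℝ (EuclideanSpace ℝ (Fin n)) = n)
  rw [this, hc.dim_eq]
  ring

/-- The Reeb fields of a contact pair commute. -/
theorem IsContactPair.mlieBracket_reeb {h k : ℕ} (hc : IsContactPair h k α₁ α₂)
    (hr : IsReebPair α₁ α₂ Z₁ Z₂) (x : M) : mlieBracket (𝓡 n) Z₁ Z₂ x = 0 := by
  have k1 := hr.isReebFor_11.mlieBracket hr.isReebFor_12 hr.isReebFor_11 x
  have k2 := hr.isReebFor_21.mlieBracket hr.isReebFor_22 hr.isReebFor_22 x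
  exact hc.eq_zero k1.1 k2.1 k1.2 k2.2

/-! ### Nijenhuis tensors of φ + cR -/

/-- The mixed part of the Nijenhuis tensor of a sum of two fields of endomorphisms. -/
def nijenhuisMixed (A B : SmoothEndField n M) (X Y : SmoothVectorField n M) (x : M) :
    TangentSpace (𝓡 n) x :=
  A x (B x (mlieBracket (𝓡 n) X Y x)) + B x (A x (mlieBracket (𝓡 n) X Y x))
    + mlieBracket (𝓡 n) (applyField A X) (applyField B Y) x
    + mlieBracket (𝓡 n) (applyField B X) (applyField A Y) x
    - A x (mlieBracket (𝓡 n) (applyField B X) Y x)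
    - B x (mlieBracket (𝓡 n) (applyField A X) Y x)
    - A x (mlieBracket (𝓡 n) X (applyField B Y) x)
    - B x (mlieBracket (𝓡 n) X (applyField A Y) x)

theorem diffFieldAt_applyField (A : SmoothEndField n M) (X : SmoothVectorField n M) (x : M) :
    DiffFieldAt (applyField A X) x :=
  (applySection A X).mdifferentiableAt

theorem applyField_add_smul (A B : SmoothEndField n M) (c : ℝ)
    (X : Π x : M, TangentSpace (𝓡 n) x) :
    applyField (A + c • B) X = applyField A X + c • applyField B X := rfl

theorem diffFieldAt_const_smul {X : Π x : M, TangentSpace (𝓡 n) x} {x : M} (c : ℝ)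
    (hX : DiffFieldAt X x) : DiffFieldAt (c • X) x :=
  (mdifferentiableAt_const (c := c)).smul_section hX

/-- Since `c` is a constant, it passes through the brackets without derivative terms; `c = 1` and `c
= -1` treat J and T together. -/
theorem nijenhuis_add_smul (A B : SmoothEndField n M) (c : ℝ) (X Y : SmoothVectorField n M)
    (x : M) : nijenhuis (A + c • B) X Y x =
      nijenhuis A X Y x + c • nijenhuisMixed A B X Y x + c ^ 2 • nijenhuis B X Y x := by
  have hl : ∀ (X : SmoothVectorField n M) (W : Π x : M, TangentSpace (𝓡 n) x),
      mlieBracket (𝓡 n) (applyField (A + c • B) X) W x =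
        mlieBracket (𝓡 n) (applyField A X) W x + c • mlieBracket (𝓡 n) (applyField B X) W x := by
    intro X W
    rw [applyField_add_smul, mlieBracket_add_left (diffFieldAt_applyField A X x)
      (diffFieldAt_const_smul c (diffFieldAt_applyField B X x)),
      mlieBracket_const_smul_left (diffFieldAt_applyField B X x)]
  have hr : ∀ (X : SmoothVectorField n M) (W : Π x : M, TangentSpace (𝓡 n) x),
      mlieBracket (𝓡 n) W (applyField (A + c • B) X) x =
        mlieBracket (𝓡 n) W (applyField A X) x + c • mlieBracket (𝓡 n) W (applyField B X) x := by
    intro X W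
    rw [applyField_add_smul, mlieBracket_add_right (diffFieldAt_applyField A X x)
      (diffFieldAt_const_smul c (diffFieldAt_applyField B X x)),
      mlieBracket_const_smul_right (diffFieldAt_applyField B X x)]
  have hap : ∀ v, (A + c • B) x v = A x v + c • B x v := fun _ ↦ rfl
  simp only [nijenhuis, nijenhuisMixed, hl, hr, hap, map_add, map_smul]
  module

/-- The field of endomorphisms `α₁ ⊗ Z₂ - α₂ ⊗ Z₁`. -/
def reebRotation (α₁ α₂ : SmoothOneForm n M) (Z₁ Z₂ : SmoothVectorField n M) :
    SmoothEndField n M :=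
  tensor α₁ Z₂ - tensor α₂ Z₁

section

variable {α₁ α₂ : SmoothOneForm n M} {Z₁ Z₂ : SmoothVectorField n M} {φ : SmoothEndField n M}

theorem reebRotation_apply (x : M) (v : TangentSpace (𝓡 n) x) :
    reebRotation α₁ α₂ Z₁ Z₂ x v = α₁ x v • Z₂ x - α₂ x v • Z₁ x := rfl

theorem almostComplexJ_eq :
    almostComplexJ α₁ α₂ Z₁ Z₂ φ = φ + (1 : ℝ) • reebRotation α₁ α₂ Z₁ Z₂ := by
  rw [almostComplexJ, reebRotation, one_smul]; abel

theorem almostComplexT_eq :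
    almostComplexT α₁ α₂ Z₁ Z₂ φ = φ + (-1 : ℝ) • reebRotation α₁ α₂ Z₁ Z₂ := by
  refine ContMDiffSection.ext fun x ↦ ContinuousLinearMap.ext fun v ↦ ?_
  change φ x v + α₂ x v • Z₁ x - α₁ x v • Z₂ x =
    φ x v + (-1 : ℝ) • (α₁ x v • Z₂ x - α₂ x v • Z₁ x)
  module

theorem mlieBracket_reebRotation_right (V : Π x : M, TangentSpace (𝓡 n) x)
    (X : SmoothVectorField n M) (x : M) :
    mlieBracket (𝓡 n) V (applyField (reebRotation α₁ α₂ Z₁ Z₂) X) x =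
      dirDeriv (fun y ↦ α₁ y (X y)) x (V x) • Z₂ x + α₁ x (X x) • mlieBracket (𝓡 n) V Z₂ x
        - dirDeriv (fun y ↦ α₂ y (X y)) x (V x) • Z₁ x
        - α₂ x (X x) • mlieBracket (𝓡 n) V Z₁ x := by
  have h1 := mdifferentiableAt_pairing α₁ (X.mdifferentiableAt (x := x))
  have h2 := mdifferentiableAt_pairing α₂ (X.mdifferentiableAt (x := x))
  have e : applyField (reebRotation α₁ α₂ Z₁ Z₂) X = (fun y ↦ α₁ y (X y)) • ⇑Z₂
      + (-1 : ℝ) • ((fun y ↦ α₂ y (X y)) • ⇑Z₁) := by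
    ext1 y
    simp [applyField, reebRotation_apply, sub_eq_add_neg]
  have d1 : DiffFieldAt ((fun y ↦ α₁ y (X y)) • ⇑Z₂) x := h1.smul_section Z₂.mdifferentiableAt
  have d2 : DiffFieldAt ((fun y ↦ α₂ y (X y)) • ⇑Z₁) x := h2.smul_section Z₁.mdifferentiableAt
  rw [e, mlieBracket_add_right d1 (diffFieldAt_const_smul _ d2), mlieBracket_const_smul_right d2,
    mlieBracket_smul_right h1 Z₂.mdifferentiableAt, mlieBracket_smul_right h2 Z₁.mdifferentiableAt]
  module

theorem mlieBracket_reebRotation_left (V : Π x : M, TangentSpace (𝓡 n) x)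
    (X : SmoothVectorField n M) (x : M) :
    mlieBracket (𝓡 n) (applyField (reebRotation α₁ α₂ Z₁ Z₂) X) V x =
      -(dirDeriv (fun y ↦ α₁ y (X y)) x (V x) • Z₂ x + α₁ x (X x) • mlieBracket (𝓡 n) V Z₂ x
        - dirDeriv (fun y ↦ α₂ y (X y)) x (V x) • Z₁ x
        - α₂ x (X x) • mlieBracket (𝓡 n) V Z₁ x) := by
  rw [mlieBracket_swap_apply, mlieBracket_reebRotation_right]

/-- The Nijenhuis tensor of `α₁ ⊗ Z₂ - α₂ ⊗ Z₁` when the Reeb fields commute. -/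
theorem nijenhuis_reebRotation (hr : IsReebPair α₁ α₂ Z₁ Z₂)
    (hZ : ∀ x, mlieBracket (𝓡 n) Z₁ Z₂ x = 0) (X Y : SmoothVectorField n M) (x : M) :
    nijenhuis (reebRotation α₁ α₂ Z₁ Z₂) X Y x =
      (2 * extD α₁ x ![X x, Y x]) • Z₁ x + (2 * extD α₂ x ![X x, Y x]) • Z₂ x := by
  have hZ' : mlieBracket (𝓡 n) Z₂ Z₁ x = 0 := by rw [mlieBracket_swap_apply, hZ, neg_zero]
  have key : ∀ {α : SmoothOneForm n M} {Z : SmoothVectorField n M} {c : ℝ}, IsReebFor α Z c →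
      ∀ V : SmoothVectorField n M, α x (mlieBracket (𝓡 n) V Z x) =
        -dirDeriv (fun y ↦ α y (V y)) x (Z x) := by
    intro α Z c h V
    rw [mlieBracket_swap_apply, map_neg, h.apply_mlieBracket V.mdifferentiableAt]
  have hxy1 := two_mul_extD_apply α₁ (X.mdifferentiableAt (x := x)) (Y.mdifferentiableAt (x := x))
  have hxy2 := two_mul_extD_apply α₂ (X.mdifferentiableAt (x := x)) (Y.mdifferentiableAt (x := x))
  have a11 := hr.apply_11 x
  have a12 := hr.apply_12 x
  have a21 := hr.apply_21 x
  have a22 := hr.apply_22 x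
  have e : ∀ V : SmoothVectorField n M, applyField (reebRotation α₁ α₂ Z₁ Z₂) V x =
    α₁ x (V x) • Z₂ x - α₂ x (V x) • Z₁ x := fun _ ↦ rfl
  rw [hxy1, hxy2, nijenhuis]
  -- As R² = -α₁ ⊗ Z₁ - α₂ ⊗ Z₂, the term R²[X, Y] and the derivatives along X and Y in R[RX, Y] and
  -- R[X, RY] assemble to 2dαᵢ(X, Y). The derivatives along Reeb fields cancel against those of [RX,
  -- RY].
  simp only [mlieBracket_reebRotation_right, mlieBracket_reebRotation_left, reebRotation_apply,
    map_add, map_sub, map_neg, map_smul, e, hZ, hZ', mlieBracket_self, Pi.zero_apply,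
    key hr.isReebFor_11, key hr.isReebFor_12, key hr.isReebFor_21, key hr.isReebFor_22,
    a11, a12, a21, a22, smul_eq_mul]
  module

/-! ### Contact pair structures and the normality tensor -/

/-- Computing φ³v as φ(φ²v) and as φ²(φv) gives α₁(φv)Z₁ + α₂(φv)Z₂ = 0; pairing with α₁ and α₂
isolates the coefficients. -/
theorem IsContactPairStructure.apply_phi {h k : ℕ}
    (hφ : IsContactPairStructure h k α₁ α₂ Z₁ Z₂ φ) (x : M) (v : TangentSpace (𝓡 n) x) :
    α₁ x (φ x v) = 0 ∧ α₂ x (φ x v) = 0 := by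
  have h1 := hφ.sq_eq x (φ x v)
  rw [hφ.sq_eq x v, map_add, map_add, map_neg, map_smul, map_smul, hφ.apply_reeb₁,
    hφ.apply_reeb₂, smul_zero, smul_zero, add_zero, add_zero, add_assoc, left_eq_add] at h1
  have e1 := congrArg (α₁ x) h1
  have e2 := congrArg (α₂ x) h1
  have hr := hφ.isReebPair
  rw [map_add, map_smul, map_smul, hr.apply_11, hr.apply_12, map_zero] at e1
  rw [map_add, map_smul, map_smul, hr.apply_21, hr.apply_22, map_zero] at e2
  simpa using And.intro e1 e2

/-- Here φR = Rφ = 0 and R² = -α₁ ⊗ Z₁ - α₂ ⊗ Z₂, so the square is φ² + c²R² = -Id. -/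
theorem IsContactPairStructure.isAlmostComplex {h k : ℕ}
    (hφ : IsContactPairStructure h k α₁ α₂ Z₁ Z₂ φ) {c : ℝ} (hc : c ^ 2 = 1) :
    IsAlmostComplex (φ + c • reebRotation α₁ α₂ Z₁ Z₂) := by
  intro x v
  have hap : ∀ v, (φ + c • reebRotation α₁ α₂ Z₁ Z₂) x v =
      φ x v + c • (α₁ x v • Z₂ x - α₂ x v • Z₁ x) := fun _ ↦ rfl
  have hr := hφ.isReebPair
  simp only [hap, map_add, map_sub, map_smul, hφ.sq_eq, hφ.apply_reeb₁, hφ.apply_reeb₂,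
    (hφ.apply_phi x v).1, (hφ.apply_phi x v).2, hr.apply_11, hr.apply_12, hr.apply_21, hr.apply_22,
    smul_eq_mul]
  linear_combination (norm := module) hc • (-(α₁ x v • Z₁ x) - α₂ x v • Z₂ x)

/-- The tensor whose vanishing characterises normality. -/
abbrev normalityTensor (α₁ α₂ : SmoothOneForm n M) (Z₁ Z₂ : SmoothVectorField n M)
    (φ : SmoothEndField n M) (X Y : SmoothVectorField n M) (x : M) : TangentSpace (𝓡 n) x :=
  nijenhuis φ X Y x + (2 * extD α₁ x ![X x, Y x]) • Z₁ x + (2 * extD α₂ x ![X x, Y x]) • Z₂ x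

/-- The quadratic term does not see the sign of `c`, so J and T share the normality tensor and
differ only in the sign of the mixed part. -/
theorem IsContactPairStructure.nijenhuis_add_smul_reebRotation {h k : ℕ}
    (hφ : IsContactPairStructure h k α₁ α₂ Z₁ Z₂ φ) {c : ℝ} (hc : c ^ 2 = 1)
    (X Y : SmoothVectorField n M) (x : M) :
    nijenhuis (φ + c • reebRotation α₁ α₂ Z₁ Z₂) X Y x =
      normalityTensor α₁ α₂ Z₁ Z₂ φ X Y x
        + c • nijenhuisMixed φ (reebRotation α₁ α₂ Z₁ Z₂) X Y x := by
  rw [nijenhuis_add_smul, hc, one_smul, nijenhuis_reebRotation hφ.isReebPair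
    (hφ.isContactPair.mlieBracket_reeb hφ.isReebPair), normalityTensor]
  abel

/-- Bracketing with a Reeb field commutes with `φ` when the normality tensor vanishes. -/
theorem IsContactPairStructure.mlieBracket_phi {h k : ℕ}
    (hφ : IsContactPairStructure h k α₁ α₂ Z₁ Z₂ φ)
    (hE : ∀ X Y x, normalityTensor α₁ α₂ Z₁ Z₂ φ X Y x = 0) {Z : SmoothVectorField n M} {c d : ℝ}
    (h₁ : IsReebFor α₁ Z c) (h₂ : IsReebFor α₂ Z d) (hZ : ∀ x, φ x (Z x) = 0)
    (X : SmoothVectorField n M) (x : M) :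
    mlieBracket (𝓡 n) (applyField φ X) Z x = φ x (mlieBracket (𝓡 n) X Z x) := by
  have hE' := hE X Z x
  have hZ0 : applyField φ Z = 0 := funext hZ
  have hα : ∀ (α : SmoothOneForm n M) (c : ℝ), IsReebFor α Z c → (∀ x v, α x (φ x v) = 0) →
      α x (mlieBracket (𝓡 n) (applyField φ X) Z x) = 0 := by
    intro α c h hα
    rw [mlieBracket_swap_apply, map_neg, h.apply_mlieBracket_eq_zero (d := 0)
      (diffFieldAt_applyField φ X x) (.of_forall fun y ↦ hα y _), neg_zero]
  have k1 := hα α₁ c h₁ fun x v ↦ (hφ.apply_phi x v).1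
  have k2 := hα α₂ d h₂ fun x v ↦ (hφ.apply_phi x v).2
  -- With Y = Z the dα terms and every bracket with φZ vanish, leaving φ²[X, Z] = φ[φX, Z].
  rw [normalityTensor, ← extDBilin_apply, ← extDBilin_apply, h₁.contract_right, h₂.contract_right,
    nijenhuis, hZ0, mlieBracket_zero_right, mlieBracket_zero_right] at hE'
  simp only [Pi.zero_apply, map_zero, mul_zero, zero_smul, add_zero, sub_zero] at hE'
  -- Applying φ once more inverts it up to sign: φ³ = -φ, and φ² = -Id on [φX, Z], which lies in
  -- both kernels by `k1` and `k2`.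
  have hE'' := congrArg (φ x) hE'
  rw [map_sub, hφ.sq_eq x (φ x _), hφ.sq_eq x (mlieBracket _ _ _ _), (hφ.apply_phi _ _).1,
    (hφ.apply_phi _ _).2, k1, k2, map_zero] at hE''
  linear_combination (norm := module) hE''

/-- `dα(φX, Y) + dα(X, φY) = 0` when the normality tensor vanishes. -/
theorem IsContactPairStructure.extD_phi {h k : ℕ}
    (hφ : IsContactPairStructure h k α₁ α₂ Z₁ Z₂ φ)
    (hE : ∀ X Y x, normalityTensor α₁ α₂ Z₁ Z₂ φ X Y x = 0)
    {α : SmoothOneForm n M} {c d : ℝ} (h₁ : IsReebFor α Z₁ c) (h₂ : IsReebFor α Z₂ d)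
    (hα : ∀ x v, α x (φ x v) = 0)
    (hαE : ∀ (X Y : SmoothVectorField n M) (x : M),
      α x ((2 * extD α₁ x ![X x, Y x]) • Z₁ x + (2 * extD α₂ x ![X x, Y x]) • Z₂ x) =
        2 * extD α x ![X x, Y x])
    (X Y : SmoothVectorField n M) (x : M) :
    extDBilin α x (φ x (X x)) (Y x) + extDBilin α x (X x) (φ x (Y x)) = 0 := by
  have key : ∀ X Y : SmoothVectorField n M,
      extDBilin α x (φ x (X x)) (φ x (Y x)) = extDBilin α x (X x) (Y x) := by
    intro X Y
    have hb := two_mul_extD_apply α (diffFieldAt_applyField φ X x) (diffFieldAt_applyField φ Y x)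
    rw [dirDeriv_of_eventuallyEq (f := fun y ↦ α y (applyField φ Y y)) (g := fun _ ↦ 0)
        (.of_forall fun y ↦ hα y (Y y)),
      dirDeriv_of_eventuallyEq (f := fun y ↦ α y (applyField φ X y)) (g := fun _ ↦ 0)
        (.of_forall fun y ↦ hα y (X y)),
      dirDeriv_const, dirDeriv_const] at hb
    -- As α ∘ φ = 0, what remains is α([φX, φY]) + 2dα(X, Y) = 0, where the bracket term equals
    -- -2dα(φX, φY). The hypothesis `hαE` lets one argument serve both α₁ and α₂.
    have hE' := congrArg (α x) (hE X Y x)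
    rw [normalityTensor, add_assoc, map_add, hαE, nijenhuis, map_sub, map_sub, map_add, hα, hα, hα,
      map_zero] at hE'
    rw [extDBilin_apply, extDBilin_apply]
    change 2 * extD α x ![φ x (X x), φ x (Y x)] = _ at hb
    linarith
  -- Replacing Y by φY turns φ²Y into -Y modulo Reeb fields, which contract dα to zero.
  have h1 := key X (applySection φ Y)
  have e : applySection φ Y x = φ x (Y x) := rfl
  rw [e, hφ.sq_eq, map_add, map_add, map_neg, map_smul, map_smul, h₁.contract_right,
    h₂.contract_right] at h1
  simp only [smul_zero, add_zero] at h1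
  linarith

/-- The mixed part of the Nijenhuis tensors of `J` and `T` vanishes with the normality tensor. -/
theorem IsContactPairStructure.nijenhuisMixed_eq_zero {h k : ℕ}
    (hφ : IsContactPairStructure h k α₁ α₂ Z₁ Z₂ φ)
    (hE : ∀ X Y x, normalityTensor α₁ α₂ Z₁ Z₂ φ X Y x = 0)
    (X Y : SmoothVectorField n M) (x : M) :
    nijenhuisMixed φ (reebRotation α₁ α₂ Z₁ Z₂) X Y x = 0 := by
  have hr := hφ.isReebPair
  have l1 := hφ.mlieBracket_phi hE hr.isReebFor_11 hr.isReebFor_21 hφ.apply_reeb₁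
  have l2 := hφ.mlieBracket_phi hE hr.isReebFor_12 hr.isReebFor_22 hφ.apply_reeb₂
  have hα₁ : ∀ x v, α₁ x (φ x v) = 0 := fun x v ↦ (hφ.apply_phi x v).1
  have hα₂ : ∀ x v, α₂ x (φ x v) = 0 := fun x v ↦ (hφ.apply_phi x v).2
  have d1 := hφ.extD_phi hE hr.isReebFor_11 hr.isReebFor_12 hα₁
    (fun X Y x ↦ by simp [hr.apply_11, hr.apply_12]) X Y x
  have d2 := hφ.extD_phi hE hr.isReebFor_21 hr.isReebFor_22 hα₂
    (fun X Y x ↦ by simp [hr.apply_21, hr.apply_22]) X Y x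
  have b : ∀ α : SmoothOneForm n M, (∀ x v, α x (φ x v) = 0) →
      α x (mlieBracket (𝓡 n) (applyField φ X) Y x) + α x (mlieBracket (𝓡 n) X (applyField φ Y) x) =
      dirDeriv (fun y ↦ α y (Y y)) x (φ x (X x)) - dirDeriv (fun y ↦ α y (X y)) x (φ x (Y x))
        - 2 * (extDBilin α x (φ x (X x)) (Y x) + extDBilin α x (X x) (φ x (Y x))) := by
    intro α hα
    have e1 := two_mul_extD_apply α (diffFieldAt_applyField φ X x) (Y.mdifferentiableAt (x := x))
    have e2 := two_mul_extD_apply α (X.mdifferentiableAt (x := x)) (diffFieldAt_applyField φ Y x)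
    rw [dirDeriv_of_eventuallyEq (f := fun y ↦ α y (applyField φ X y)) (g := fun _ ↦ 0)
      (.of_forall fun y ↦ hα y (X y)), dirDeriv_const] at e1
    rw [dirDeriv_of_eventuallyEq (f := fun y ↦ α y (applyField φ Y y)) (g := fun _ ↦ 0)
      (.of_forall fun y ↦ hα y (Y y)), dirDeriv_const] at e2
    change 2 * extDBilin α x (φ x (X x)) (Y x) = dirDeriv _ x (φ x (X x)) - _ - _ at e1
    change 2 * extDBilin α x (X x) (φ x (Y x)) = _ - dirDeriv _ x (φ x (Y x)) - _ at e2
    linarith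
  have b1 := b α₁ hα₁
  have b2 := b α₂ hα₂
  rw [d1] at b1
  rw [d2] at b2
  have e : ∀ V : SmoothVectorField n M, applyField φ V x = φ x (V x) := fun _ ↦ rfl
  -- The brackets with Z₁ and Z₂ cancel by `l1` and `l2`. The remaining coefficients of Z₂ and Z₁
  -- are, up to sign, the differences of the two sides of `b1` and `b2`.
  simp only [nijenhuisMixed, mlieBracket_reebRotation_right, mlieBracket_reebRotation_left,
    reebRotation_apply, l1, l2, hα₁, hα₂, map_add, map_sub, map_neg, map_smul, hφ.apply_reeb₁,
    hφ.apply_reeb₂, e]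
  linear_combination (norm := module) b2 • Z₁ x - b1 • Z₂ x

end

end

end ContactPair

theorem mainTheorem3 (h k n : ℕ) (M : Type*) [TopologicalSpace M]
    [ChartedSpace (EuclideanSpace ℝ (Fin n)) M] [IsManifold (𝓡 n) ∞ M]
    (α₁ α₂ : ContactPair.SmoothOneForm n M) (Z₁ Z₂ : ContactPair.SmoothVectorField n M)
    (φ : ContactPair.SmoothEndField n M)
    (hφ : ContactPair.IsContactPairStructure h k α₁ α₂ Z₁ Z₂ φ) :
    ContactPair.IsAlmostComplex (ContactPair.almostComplexJ α₁ α₂ Z₁ Z₂ φ) ∧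
    ContactPair.IsAlmostComplex (ContactPair.almostComplexT α₁ α₂ Z₁ Z₂ φ) ∧
    ((ContactPair.IsIntegrable (ContactPair.almostComplexJ α₁ α₂ Z₁ Z₂ φ) ∧
        ContactPair.IsIntegrable (ContactPair.almostComplexT α₁ α₂ Z₁ Z₂ φ)) ↔
      ∀ (X Y : ContactPair.SmoothVectorField n M) (x : M),
        ContactPair.nijenhuis φ X Y x
          + (2 * ContactPair.extD α₁ x ![X x, Y x]) • Z₁ x
          + (2 * ContactPair.extD α₂ x ![X x, Y x]) • Z₂ x = 0) := by
  have hJ : (1 : ℝ) ^ 2 = 1 := by norm_num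
  have hT : (-1 : ℝ) ^ 2 = 1 := by norm_num
  rw [ContactPair.almostComplexJ_eq, ContactPair.almostComplexT_eq]
  refine ⟨hφ.isAlmostComplex hJ, hφ.isAlmostComplex hT, ?_, fun hE ↦ ⟨?_, ?_⟩⟩
  · rintro ⟨iJ, iT⟩ X Y x
    have e1 := iJ X Y x
    have e2 := iT X Y x
    rw [hφ.nijenhuis_add_smul_reebRotation hJ] at e1
    rw [hφ.nijenhuis_add_smul_reebRotation hT] at e2
    -- The mixed parts cancel in the mean of N_J and N_T.
    linear_combination (norm := module) (1 / 2 : ℝ) • e1 + (1 / 2 : ℝ) • e2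
  · intro X Y x
    rw [hφ.nijenhuis_add_smul_reebRotation hJ, hφ.nijenhuisMixed_eq_zero hE, smul_zero, add_zero]
    exact hE X Y x
  · intro X Y x
    rw [hφ.nijenhuis_add_smul_reebRotation hT, hφ.nijenhuisMixed_eq_zero hE, smul_zero, add_zero]
    exact hE X Y x
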